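/- Let $\mathcal S$ be a cancellative abelian semigroup with identity $e$, let $A$ be a unital C*-algebra, and let $\alpha$ be an action of $\mathcal S$ on $A$ by (not necessarily unital or injective) $*$-endomorphisms $\alpha_x$, so that $\alpha_{xy}=\alpha_x\circ\alpha_y$ and $\alpha_e=\mathrm{id}$. Let $A\rtimes\mathcal S$ be the semigroup crossed product, i.e. the universal unital C*-algebra generated by the image of a unital $*$-homomorphism $\iota$ of $A$ and isometries $v_x$, $x\in\mathcal S$, such that $v_xv_y=v_{xy}$ and $v_x\iota(a)v_x^*=\iota(\alpha_x(a))$. Let $x\mapsto N_x$ be an injective homomorphism from $\mathcal S$ to the multiplicative group $\mathbb R_+^*$ of positive reals, and let $\sigma$ be the one-parameter automorphism group of $A\rtimes\mathcal S$ determined by $\sigma_t(\iota(a))=\iota(a)$ and $\sigma_t(v_x)=N_x^{it}v_x$. For $\beta\in\mathbb R$, a $\sigma$-KMS$_\beta$-state is a $\sigma$-invariant state $\varphi$ such that $\varphi(bc)=\varphi(c\,\sigma_{i\beta}(b))$ for all $\sigma$-analytic elements $b,c$, where $b$ is $\sigma$-analytic if $t\mapsto\sigma_t(b)$ extends to an entire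 function $z\mapsto\sigma_z(b)$. Then for every $\beta\in\mathbb R$ there is a one-to-one correspondence between the $\sigma$-KMS$_\beta$-states $\varphi$ on $A\rtimes\mathcal S$ and the tracial states $\tau$ on $A$ such that $\tau\circ\alpha_x=N_x^{-\beta}\tau$ for every $x\in\mathcal S$. Explicitly, the state $\varphi$ corresponding to $\tau$ is the unique state on $A\rtimes\mathcal S$ such that, for all $x,y\in\mathcal S$ and $a\in A$, $$\varphi(v_x^*\iota(a)v_y)=\begin{cases}N_x^{\beta}\,\tau(a\,\alpha_x(1)),&x=y,\\0,&x\neq y.\end{cases}$$ -/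

import Mathlib

open scoped ENNReal ComplexOrder

universe u v w

namespace SemigroupCrossedProduct

noncomputable section

/-! ### Small C*-algebras -/

/-- A C*-algebra whose underlying type is small has a *-isomorphic copy in the smaller universe. -/
theorem exists_starAlgEquiv_of_small (D : Type w) [CStarAlgebra D] [Small.{u} D] :
    ∃ (E : Type u) (_ : CStarAlgebra E), Nonempty (E ≃⋆ₐ[ℂ] D) := by
  let e : Shrink.{u} D ≃ D := (equivShrink D).symm
  let i1 : NormedRing (Shrink.{u} D) := e.normedRing
  let i2 : StarRing (Shrink.{u} D) := e.starRing
  let i3 : Algebra ℂ (Shrink.{u} D) := e.algebra ℂ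
  have hmul : ∀ x y, e (x * y) = e x * e y := fun x y => e.apply_symm_apply _
  have hadd : ∀ x y, e (x + y) = e x + e y := fun x y => e.apply_symm_apply _
  have hsmul : ∀ (c : ℂ) x, e (c • x) = c • e x := fun c x => e.apply_symm_apply _
  have hstar : ∀ x, e (star x) = star (e x) := fun x => e.apply_symm_apply _
  have hnorm : ∀ x, ‖x‖ = ‖e x‖ := fun x => rfl
  let i4 : NormedAlgebra ℂ (Shrink.{u} D) :=
    { i3 with norm_smul_le := fun c x => by rw [hnorm, hsmul, hnorm]; exact norm_smul_le _ _ }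
  have hiso : Isometry e := Isometry.of_dist_eq fun x y => rfl
  let i5 : CompleteSpace (Shrink.{u} D) :=
    (hiso.isUniformInducing.completeSpace_congr e.surjective).mpr inferInstance
  let i6 : CStarRing (Shrink.{u} D) :=
    ⟨fun x => by rw [hnorm, hnorm, hmul, hstar]; exact CStarRing.norm_mul_self_le _⟩
  let i7 : StarModule ℂ (Shrink.{u} D) :=
    ⟨fun c x => e.injective (by rw [hstar, hsmul, hsmul, hstar, star_smul])⟩
  let i8 : CStarAlgebra (Shrink.{u} D) := { i1, i2, i4, i5, i6, i7 with }
  exact ⟨Shrink.{u} D, i8, ⟨{ e with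
    map_mul' := hmul
    map_add' := hadd
    map_smul' := hsmul
    map_star' := hstar }⟩⟩

/-- The closed unital *-subalgebra generated by a small set is small. -/
theorem small_topologicalClosure_adjoin (D : Type w) [CStarAlgebra D] (s : Set D)
    [Small.{u} s] : Small.{u} (StarAlgebra.adjoin ℂ s).topologicalClosure := by
  have h1 : Small.{u} (star s : Set D) := by
    rw [← Set.image_star]; infer_instance
  have h2 : Small.{u} (s ∪ star s : Set D) := by infer_instance
  have h3 : Small.{u} (Algebra.adjoin ℂ (s ∪ star s) : Set D) := by
    let f : Shrink.{u} (s ∪ star s : Set D) → D := fun x => (((equivShrink (s ∪ star s : Set D)).symm x : (s ∪ star s : Set D)) : D)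
    have hf : Set.range f = s ∪ star s := by
      ext y
      constructor
      · rintro ⟨x, rfl⟩
        exact ((equivShrink (s ∪ star s : Set D)).symm x).2
      · intro hy
        exact ⟨equivShrink _ ⟨y, hy⟩, by simp [f]⟩
    rw [← hf, Algebra.adjoin_range_eq_range_freeAlgebra_lift, AlgHom.coe_range]
    infer_instance
  have h4 : Small.{u} (StarAlgebra.adjoin ℂ s : Set D) := h3
  have h5 : Small.{u} (closure (StarAlgebra.adjoin ℂ s : Set D)) := by
    have hf : ∀ y : closure (StarAlgebra.adjoin ℂ s : Set D),
        ∃ f : ℕ → (StarAlgebra.adjoin ℂ s : Set D),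
          Filter.Tendsto (fun n => (f n : D)) Filter.atTop (nhds y) := fun y => by
      obtain ⟨f, hf, hfy⟩ := mem_closure_iff_seq_limit.mp y.2
      exact ⟨fun n => ⟨f n, hf n⟩, hfy⟩
    choose F hF using hf
    refine small_of_injective (f := F) fun y z hyz => Subtype.ext ?_
    exact tendsto_nhds_unique (hF y) (hyz ▸ hF z)
  exact h5

/-! ### Covariant pairs and the crossed product -/

variable {A : Type u} [CStarAlgebra A] {S : Type v} [CancelCommMonoid S]

/-- A covariant pair for an action `α` of the monoid `S` by (not necessarily unital, not
necessarily injective) *-endomorphisms of `A`, with values in the unital C*-algebra `D`: a unital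
*-homomorphism `ι` of `A` and isometries `v x` with `v (x * y) = v x * v y` and
`v x * ι a * (v x)^* = ι (α x a)`. -/
structure CovariantPair (α : S →* (A →⋆ₙₐ[ℂ] A)) (D : Type w) [CStarAlgebra D] where
  ι : A →⋆ₐ[ℂ] D
  v : S →* D
  isometry : ∀ x, star (v x) * v x = 1
  covariance : ∀ x a, v x * ι a * star (v x) = ι (α x a)

/-- The image of a covariant pair under a unital *-homomorphism. -/
def CovariantPair.map {α : S →* (A →⋆ₙₐ[ℂ] A)} {D E : Type*} [CStarAlgebra D] [CStarAlgebra E]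
    (p : CovariantPair α D) (f : D →⋆ₐ[ℂ] E) : CovariantPair α E where
  ι := f.comp p.ι
  v := (f : D →* E).comp p.v
  isometry := fun x => by
    change star (f (p.v x)) * f (p.v x) = 1
    rw [← map_star, ← map_mul, p.isometry, map_one]
  covariance := fun x a => by
    change f (p.v x) * f (p.ι a) * star (f (p.v x)) = f (p.ι (α x a))
    rw [← map_star, ← map_mul, ← map_mul, p.covariance]

/-- A covariant pair with values in a closed unital *-subalgebra. -/
def CovariantPair.codRestrict {α : S →* (A →⋆ₙₐ[ℂ] A)} {D : Type w} [CStarAlgebra D]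
    (p : CovariantPair α D) (T : StarSubalgebra ℂ D) [IsClosed (T : Set D)]
    (hι : ∀ a, p.ι a ∈ T) (hv : ∀ x, p.v x ∈ T) : CovariantPair α T where
  ι := p.ι.codRestrict T hι
  v :=
    { toFun := fun x => ⟨p.v x, hv x⟩
      map_one' := Subtype.ext (map_one p.v)
      map_mul' := fun x y => Subtype.ext (map_mul p.v x y) }
  isometry := fun x => Subtype.ext (p.isometry x)
  covariance := fun x a => Subtype.ext (p.covariance x a)

/-- The covariant pairs with values in nonzero unital C*-algebras of the universe of `A` and `S`. -/
structure BundledPair (α : S →* (A →⋆ₙₐ[ℂ] A)) where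
  D : Type (max u v)
  [cstar : CStarAlgebra D]
  [nontriv : Nontrivial D]
  pair : CovariantPair α D

attribute [instance] BundledPair.cstar BundledPair.nontriv

variable (α : S →* (A →⋆ₙₐ[ℂ] A))

/-- The C*-algebra of bounded families indexed by all covariant pairs. -/
abbrev Ambient : Type (max (u + 1) (v + 1)) := lp (fun r : BundledPair α => r.D) ∞

instance : CStarAlgebra (Ambient α) where

theorem CovariantPair.norm_v_le {α : S →* (A →⋆ₙₐ[ℂ] A)} {D : Type w} [CStarAlgebra D]
    [Nontrivial D] (p : CovariantPair α D) (x : S) : ‖p.v x‖ ≤ 1 := by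
  have h : ‖p.v x‖ * ‖p.v x‖ = 1 := by
    rw [← CStarRing.norm_star_mul_self, p.isometry, CStarRing.norm_one]
  nlinarith [norm_nonneg (p.v x)]

/-- The family of all `ι`. -/
def ambientι (a : A) : Ambient α :=
  ⟨fun r => r.pair.ι a, memℓp_infty ⟨‖a‖, by
    rintro _ ⟨r, rfl⟩
    exact NonUnitalStarAlgHom.norm_apply_le _ _⟩⟩

/-- The family of all `v`. -/
def ambientV (x : S) : Ambient α :=
  ⟨fun r => r.pair.v x, memℓp_infty ⟨1, by
    rintro _ ⟨r, rfl⟩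
    exact r.pair.norm_v_le x⟩⟩

/-- The direct sum of all covariant pairs. -/
def ambientPair : CovariantPair α (Ambient α) where
  ι :=
    { toFun := ambientι α
      map_one' := by ext r; exact map_one r.pair.ι
      map_mul' := fun a b => by ext r; exact map_mul r.pair.ι a b
      map_zero' := by ext r; exact map_zero r.pair.ι
      map_add' := fun a b => by ext r; exact map_add r.pair.ι a b
      commutes' := fun c => by ext r; exact AlgHomClass.commutes r.pair.ι c
      map_star' := fun a => by ext r; exact map_star r.pair.ι a }
  v :=
    { toFun := ambientV α
      map_one' := by ext r; exact map_one r.pair.v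
      map_mul' := fun x y => by ext r; exact map_mul r.pair.v x y }
  isometry := fun x => by ext r; exact r.pair.isometry x
  covariance := fun x a => by ext r; exact r.pair.covariance x a

/-- The closed unital *-subalgebra generated by the direct sum of all covariant pairs. -/
def generated : StarSubalgebra ℂ (Ambient α) :=
  (StarAlgebra.adjoin ℂ
    (Set.range (ambientPair α).ι ∪ Set.range (ambientPair α).v)).topologicalClosure

/-- The semigroup crossed product of `A` by `S`: the universal unital C*-algebra generated by a
covariant pair. Its universal property, with respect to unital C*-algebras in every universe, is
`exists_hom` together with `hom_ext`. -/
def CrossedProduct : Type (max (u + 1) (v + 1)) := generated α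

instance : CStarAlgebra (CrossedProduct α) :=
  StarSubalgebra.cstarAlgebra (generated α)
    (h_closed := StarSubalgebra.isClosed_topologicalClosure _)

theorem ι_mem (a : A) : (ambientPair α).ι a ∈ generated α :=
  StarSubalgebra.le_topologicalClosure _ (StarAlgebra.subset_adjoin ℂ _ (Or.inl ⟨a, rfl⟩))

theorem v_mem (x : S) : (ambientPair α).v x ∈ generated α :=
  StarSubalgebra.le_topologicalClosure _ (StarAlgebra.subset_adjoin ℂ _ (Or.inr ⟨x, rfl⟩))

instance : IsClosed (generated α : Set (Ambient α)) := StarSubalgebra.isClosed_topologicalClosure _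

/-- The canonical covariant pair in the crossed product. -/
def canonicalPair : CovariantPair α (CrossedProduct α) :=
  (ambientPair α).codRestrict (generated α) (ι_mem α) (v_mem α)

/-- The canonical homomorphism of `A` into the crossed product. -/
def ι : A →⋆ₐ[ℂ] CrossedProduct α := (canonicalPair α).ι

/-- The canonical isometries in the crossed product. -/
def V : S →* CrossedProduct α := (canonicalPair α).v

/-- The crossed product is generated by the canonical covariant pair. -/
theorem hom_ext {D : Type w} [CStarAlgebra D] {f g : CrossedProduct α →⋆ₐ[ℂ] D}
    (h1 : ∀ a, f (ι α a) = g (ι α a)) (h2 : ∀ x, f (V α x) = g (V α x)) : f = g := by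
  have hf : Continuous f := AddMonoidHomClass.continuous_of_bound f 1 fun b => by
    rw [one_mul]; exact NonUnitalStarAlgHom.norm_apply_le f b
  have hg : Continuous g := AddMonoidHomClass.continuous_of_bound g 1 fun b => by
    rw [one_mul]; exact NonUnitalStarAlgHom.norm_apply_le g b
  change (generated α →⋆ₐ[ℂ] D) at f g
  refine StarAlgHom.ext_topologicalClosure hf hg ?_
  refine StarAlgHom.ext_adjoin ?_
  rintro ⟨_, hx⟩ (⟨a, rfl⟩ | ⟨x, rfl⟩)
  · exact h1 a
  · exact h2 x

/-- The universal property of the crossed product (existence). -/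
theorem exists_hom {D : Type w} [CStarAlgebra D] (p : CovariantPair α D) :
    ∃ f : CrossedProduct α →⋆ₐ[ℂ] D, (∀ a, f (ι α a) = p.ι a) ∧ ∀ x, f (V α x) = p.v x := by
  rcases subsingleton_or_nontrivial D with hD | hD
  · refine ⟨{ toFun := fun _ => 0, map_one' := Subsingleton.elim _ _,
              map_mul' := fun _ _ => Subsingleton.elim _ _, map_zero' := rfl,
              map_add' := fun _ _ => Subsingleton.elim _ _,
              commutes' := fun _ => Subsingleton.elim _ _,
              map_star' := fun _ => Subsingleton.elim _ _ }, fun _ => Subsingleton.elim _ _,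
            fun _ => Subsingleton.elim _ _⟩
  · let s : Set D := Set.range p.ι ∪ Set.range p.v
    have hu : Small.{u} (Set.range p.ι) := small_range _
    have hv : Small.{v} (Set.range p.v) := small_range _
    have : Small.{max u v} (Set.range p.ι) := small_lift.{w, v, u} _
    have : Small.{max u v} (Set.range p.v) := small_lift.{w, u, v} _
    have : Small.{max u v} s := small_union _ _
    let T : StarSubalgebra ℂ D := (StarAlgebra.adjoin ℂ s).topologicalClosure
    have : Small.{max u v} T := small_topologicalClosure_adjoin D s
    have hT : IsClosed (T : Set D) := StarSubalgebra.isClosed_topologicalClosure _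
    obtain ⟨E, iE, ⟨e⟩⟩ := exists_starAlgEquiv_of_small.{max u v} T
    have : Nontrivial E := e.toEquiv.nontrivial
    have hι : ∀ a, p.ι a ∈ T := fun a =>
      StarSubalgebra.le_topologicalClosure _ (StarAlgebra.subset_adjoin ℂ _ (Or.inl ⟨a, rfl⟩))
    have hv : ∀ x, p.v x ∈ T := fun x =>
      StarSubalgebra.le_topologicalClosure _ (StarAlgebra.subset_adjoin ℂ _ (Or.inr ⟨x, rfl⟩))
    let q : CovariantPair α E := (p.codRestrict T hι hv).map (e.symm : T →⋆ₐ[ℂ] E)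
    let r : BundledPair α := { D := E, pair := q }
    let ev : Ambient α →⋆ₐ[ℂ] E :=
      { toFun := fun f => f r
        map_one' := rfl
        map_mul' := fun _ _ => rfl
        map_zero' := rfl
        map_add' := fun _ _ => rfl
        commutes' := fun _ => rfl
        map_star' := fun _ => rfl }
    refine ⟨T.subtype.comp ((e : E →⋆ₐ[ℂ] T).comp (ev.comp (generated α).subtype)), ?_, ?_⟩
    · intro a
      change ((e (e.symm ⟨p.ι a, hι a⟩) : T) : D) = p.ι a
      rw [StarAlgEquiv.apply_symm_apply]
    · intro x
      change ((e (e.symm ⟨p.v x, hv x⟩) : T) : D) = p.v x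
      rw [StarAlgEquiv.apply_symm_apply]

/-- The homomorphism given by the universal property. -/
def lift {D : Type w} [CStarAlgebra D] (p : CovariantPair α D) : CrossedProduct α →⋆ₐ[ℂ] D :=
  (exists_hom α p).choose

theorem lift_ι {D : Type w} [CStarAlgebra D] (p : CovariantPair α D) (a : A) :
    lift α p (ι α a) = p.ι a := (exists_hom α p).choose_spec.1 a

theorem lift_V {D : Type w} [CStarAlgebra D] (p : CovariantPair α D) (x : S) :
    lift α p (V α x) = p.v x := (exists_hom α p).choose_spec.2 x

/-! ### The dynamics -/

/-- Multiplying the isometries of a covariant pair by a character of `S`. -/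
def CovariantPair.twist {α : S →* (A →⋆ₙₐ[ℂ] A)} {D : Type w} [CStarAlgebra D]
    (p : CovariantPair α D) (χ : S →* Circle) : CovariantPair α D where
  ι := p.ι
  v :=
    { toFun := fun x => (χ x : ℂ) • p.v x
      map_one' := by simp
      map_mul' := fun x y => by simp [smul_smul, mul_comm] }
  isometry := fun x => by
    have h : (χ x : ℂ) * star (χ x : ℂ) = 1 := by
      rw [← starRingEnd_apply, Complex.mul_conj, Circle.normSq_coe, Complex.ofReal_one]
    simp only [MonoidHom.coe_mk, OneHom.coe_mk, star_smul, smul_mul_smul_comm, p.isometry]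
    rw [mul_comm, h, one_smul]
  covariance := fun x a => by
    have h : (χ x : ℂ) * star (χ x : ℂ) = 1 := by
      rw [← starRingEnd_apply, Complex.mul_conj, Circle.normSq_coe, Complex.ofReal_one]
    simp only [MonoidHom.coe_mk, OneHom.coe_mk, star_smul, smul_mul_assoc, mul_smul_comm,
      p.covariance, smul_smul]
    rw [mul_comm, h, one_smul]

/-- The endomorphism of the crossed product with `ι a ↦ ι a` and `V x ↦ χ x • V x`. -/
def gaugeHom (χ : S →* Circle) : CrossedProduct α →⋆ₐ[ℂ] CrossedProduct α :=
  lift α ((canonicalPair α).twist χ)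

theorem gaugeHom_ι (χ : S →* Circle) (a : A) : gaugeHom α χ (ι α a) = ι α a := lift_ι α _ a

theorem gaugeHom_V (χ : S →* Circle) (x : S) :
    gaugeHom α χ (V α x) = (χ x : ℂ) • V α x := lift_V α _ x

theorem gaugeHom_comp (χ ψ : S →* Circle) :
    (gaugeHom α χ).comp (gaugeHom α ψ) = gaugeHom α (χ * ψ) := by
  apply hom_ext
  · intro a
    rw [StarAlgHom.comp_apply, gaugeHom_ι, gaugeHom_ι, gaugeHom_ι]
  · intro x
    rw [StarAlgHom.comp_apply, gaugeHom_V, map_smul, gaugeHom_V, gaugeHom_V, smul_smul,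
      MonoidHom.mul_apply, Circle.coe_mul, mul_comm]

theorem gaugeHom_one : gaugeHom α (1 : S →* Circle) = StarAlgHom.id ℂ _ := by
  apply hom_ext
  · intro a
    rw [gaugeHom_ι]; rfl
  · intro x
    rw [gaugeHom_V, MonoidHom.one_apply, Circle.coe_one, one_smul]; rfl

/-- The dual action of the characters of `S` on the crossed product. -/
def gauge (χ : S →* Circle) : CrossedProduct α ≃⋆ₐ[ℂ] CrossedProduct α :=
  StarAlgEquiv.ofStarAlgHom (gaugeHom α χ) (gaugeHom α χ⁻¹)
    (by rw [gaugeHom_comp, inv_mul_cancel, gaugeHom_one])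
    (by rw [gaugeHom_comp, mul_inv_cancel, gaugeHom_one])

/-- The character `x ↦ N_x ^ (i t)`. -/
def character (N : S →* {r : ℝ // 0 < r}) (t : ℝ) : S →* Circle where
  toFun x := Circle.exp (t * Real.log (N x))
  map_one' := by simp
  map_mul' x y := by
    rw [map_mul N, Positive.val_mul, Real.log_mul (N x).2.ne' (N y).2.ne', mul_add, Circle.exp_add]

theorem coe_character (N : S →* {r : ℝ // 0 < r}) (t : ℝ) (x : S) :
    (character N t x : ℂ) = ((N x : ℝ) : ℂ) ^ ((t : ℂ) * Complex.I) := by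
  have h : ((N x : ℝ) : ℂ) ≠ 0 := Complex.ofReal_ne_zero.mpr (N x).2.ne'
  rw [Complex.cpow_def_of_ne_zero h, ← Complex.ofReal_log (N x).2.le]
  change (Circle.exp (t * Real.log (N x)) : ℂ) = _
  rw [Circle.coe_exp]
  push_cast
  ring_nf

/-- The one-parameter automorphism group `σ` of the crossed product determined by
`σ_t (ι a) = ι a` and `σ_t (V x) = N_x ^ (i t) • V x`, see `dynamics_ι` and `dynamics_V`. -/
def dynamics (N : S →* {r : ℝ // 0 < r}) (t : ℝ) : CrossedProduct α ≃⋆ₐ[ℂ] CrossedProduct α :=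
  gauge α (character N t)

theorem dynamics_ι (N : S →* {r : ℝ // 0 < r}) (t : ℝ) (a : A) :
    dynamics α N t (ι α a) = ι α a := gaugeHom_ι α _ a

theorem dynamics_V (N : S →* {r : ℝ // 0 < r}) (t : ℝ) (x : S) :
    dynamics α N t (V α x) = ((N x : ℝ) : ℂ) ^ ((t : ℂ) * Complex.I) • V α x := by
  rw [← coe_character]
  exact gaugeHom_V α _ x

theorem dynamics_add (N : S →* {r : ℝ // 0 < r}) (s t : ℝ) (b : CrossedProduct α) :
    dynamics α N (s + t) b = dynamics α N s (dynamics α N t b) := by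
  have h : character N (s + t) = character N s * character N t := by
    ext x
    change (Circle.exp ((s + t) * Real.log (N x)) : ℂ) =
      (Circle.exp (s * Real.log (N x)) * Circle.exp (t * Real.log (N x)) : Circle)
    rw [add_mul, Circle.exp_add]
  change gaugeHom α (character N (s + t)) b =
    gaugeHom α (character N s) (gaugeHom α (character N t) b)
  rw [h, ← gaugeHom_comp]
  rfl

/-! ### States, traces and the KMS condition -/

/-- A state of a unital C*-algebra: a positive bounded linear functional with `φ 1 = 1`. -/
def IsState {B : Type w} [CStarAlgebra B] (φ : B →L[ℂ] ℂ) : Prop :=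
  (∀ b : B, 0 ≤ φ (star b * b)) ∧ φ 1 = 1

/-- A tracial state. -/
def IsTracialState {B : Type w} [CStarAlgebra B] (τ : B →L[ℂ] ℂ) : Prop :=
  IsState τ ∧ ∀ a b : B, τ (a * b) = τ (b * a)

/-- `F` is an entire `B`-valued function extending the orbit map `t ↦ σ_t b`; then `b` is
`σ`-analytic and `F z` is `σ_z b`. -/
def IsAnalyticExtension {B : Type w} [CStarAlgebra B] (σ : ℝ → (B ≃⋆ₐ[ℂ] B)) (b : B)
    (F : ℂ → B) : Prop :=
  Differentiable ℂ F ∧ ∀ t : ℝ, F t = σ t b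

/-- `b` is a `σ`-analytic element. -/
def IsAnalyticElement {B : Type w} [CStarAlgebra B] (σ : ℝ → (B ≃⋆ₐ[ℂ] B)) (b : B) : Prop :=
  ∃ F : ℂ → B, IsAnalyticExtension σ b F

/-- `φ` is a `σ`-KMS state at inverse temperature `β`: a `σ`-invariant state with
`φ (x * y) = φ (y * σ_{iβ} x)` for all `σ`-analytic elements `x`, `y`. -/
def IsKMSState {B : Type w} [CStarAlgebra B] (σ : ℝ → (B ≃⋆ₐ[ℂ] B)) (β : ℝ)
    (φ : B →L[ℂ] ℂ) : Prop :=
  IsState φ ∧ (∀ (t : ℝ) (b : B), φ (σ t b) = φ b) ∧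
    ∀ (x y : B) (F : ℂ → B), IsAnalyticExtension σ x F → IsAnalyticElement σ y →
      φ (x * y) = φ (y * F (Complex.I * β))

/-- The `σ`-KMS states of the crossed product at inverse temperature `β`. -/
def KMSStates (N : S →* {r : ℝ // 0 < r}) (β : ℝ) : Set (CrossedProduct α →L[ℂ] ℂ) :=
  {φ | IsKMSState (dynamics α N) β φ}

/-- The tracial states `τ` of `A` with `τ ∘ α_x = N_x ^ (-β) τ` for all `x`. -/
def ScalingTraces (N : S →* {r : ℝ // 0 < r}) (β : ℝ) : Set (A →L[ℂ] ℂ) :=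
  {τ | IsTracialState τ ∧ ∀ (x : S) (a : A), τ (α x a) = (((N x : ℝ) ^ (-β) : ℝ) : ℂ) * τ a}

end

end SemigroupCrossedProduct

/-! The KMS states are determined by their restrictions to `A`, and the content of the theorem is
that every scaling trace arises as such a restriction.

Commutativity of `S` gives `V x * (V y)^* = (V y)^* * ι (α (x * y) 1) * V x` (`V_mul_star_V`), so the
monomials `(V x)^* * ι a * V y` span a *-subalgebra. It is dense because a universal algebra is
generated by its universal pair (`dense_span_monomial`). Hence a functional is determined by its
values on monomials, which are eigenvectors of the dynamics. Applied to monomials, the KMS condition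
shows that the restriction `τ` of a KMS state is a scaling trace and that the state has the asserted
values (`IsKMSState.traceFormula`); invariance kills the monomials with `x ≠ y` because `N` is
injective. Conversely, a state with these values is KMS (`TraceFormula.isKMSState`): the trace
property and the scaling give the condition for two monomials, continuity lets one of them be
replaced by any element, and the identity theorem for entire functions moves the dynamics onto that
element.

It remains to construct a state with the asserted values (`exists_state_of_scaling`). It is a vector
state in a covariant representation. Heuristically, `A` is dilated to an algebra on which the `α x`
become invertible, `τ` is dilated to a trace scaled by them, and the isometry of `s` acts on the
tensor product of the `L²`-space of that trace with `ℓ²(G)` by the dilated `α_s` and translation by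
`N s`, all cut down by the unit of `A`. Here `G` is the group of positive reals, which receives `S`
injectively. No dilation is needed to write this down: the vectors `α_x⁻¹ (a) ⊗ δ_g` have inner
products expressed by `τ` (`kernel`), the resulting form on finitely supported families is positive
because finitely many indices `x` have a common multiple (`form_self_nonneg`), and operators on the
families which satisfy the covariance relations up to the null space of the form extend to the
Hilbert space completion (`exists_covariantPair_of_form`). -/

namespace SemigroupCrossedProduct

/-! ### Monomials in the crossed product -/

section

variable {A : Type u} [CStarAlgebra A] {S : Type v} [CancelCommMonoid S]
  (α : S →* (A →⋆ₙₐ[ℂ] A))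

theorem action_mul (x y : S) (a : A) : α (x * y) a = α x (α y a) := by
  rw [map_mul]; rfl

theorem action_one (a : A) : α 1 a = a := by
  rw [map_one]; rfl

theorem action_mul_unit (x y : S) : α (x * y) 1 * α x 1 = α (x * y) 1 := by
  rw [action_mul, ← map_mul, mul_one]

theorem action_unit_mul (x y : S) : α x 1 * α (x * y) 1 = α (x * y) 1 := by
  rw [action_mul, ← map_mul, one_mul]

theorem star_V_mul_V (x : S) : star (V α x) * V α x = 1 := (canonicalPair α).isometry x

theorem V_mul_ι_mul_star_V (x : S) (a : A) :
    V α x * ι α a * star (V α x) = ι α (α x a) := (canonicalPair α).covariance x a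

theorem V_mul_star_V_self (x : S) : V α x * star (V α x) = ι α (α x 1) := by
  rw [← V_mul_ι_mul_star_V, map_one, mul_one]

theorem V_mul_ι (x : S) (a : A) : V α x * ι α a = ι α (α x a) * V α x := by
  rw [← V_mul_ι_mul_star_V, mul_assoc _ (star _), star_V_mul_V, mul_one]

theorem ι_mul_star_V (x : S) (a : A) : ι α a * star (V α x) = star (V α x) * ι α (α x a) := by
  have h := congrArg star (V_mul_ι α x (star a))
  simpa [map_star] using h

/-- Commutativity of the semigroup lets every `V x * (V y)^*` be rewritten with the adjoint
on the left. -/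
theorem V_mul_star_V (x y : S) :
    V α x * star (V α y) = star (V α y) * ι α (α (x * y) 1) * V α x := by
  calc V α x * star (V α y)
      = star (V α y) * (V α y * V α x) * star (V α y) := by
        rw [← mul_assoc (star _), star_V_mul_V, one_mul]
    _ = star (V α y) * V α x * (V α y * star (V α y)) := by
        rw [← map_mul, mul_comm y x, map_mul]; simp only [mul_assoc]
    _ = _ := by
        rw [V_mul_star_V_self, mul_assoc, V_mul_ι, ← action_mul, mul_assoc]

/-- The elements `(V x)^* * ι a * V y`, which span a dense *-subalgebra. -/
noncomputable def monomial (x : S) (a : A) (y : S) : CrossedProduct α :=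
  star (V α x) * ι α a * V α y

theorem monomial_mul (x y z w : S) (a b : A) :
    monomial α x a y * monomial α z b w =
      monomial α (z * x) (α z a * α (y * z) 1 * α y b) (y * w) := by
  calc monomial α x a y * monomial α z b w
      = star (V α x) * ι α a * (V α y * star (V α z)) * (ι α b * V α w) := by
        simp only [monomial, mul_assoc]
    _ = star (V α x) * (ι α a * star (V α z)) * ι α (α (y * z) 1) * (V α y * ι α b) * V α w := by
        rw [V_mul_star_V]; simp only [mul_assoc]
    _ = _ := by
        rw [V_mul_ι, ι_mul_star_V, monomial]
        simp only [map_mul, star_mul, mul_assoc]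

theorem star_monomial (x y : S) (a : A) :
    star (monomial α x a y) = monomial α y (star a) x := by
  simp [monomial, mul_assoc, map_star]

theorem monomial_one_one (a : A) : monomial α 1 a 1 = ι α a := by
  simp [monomial]

theorem monomial_one_one_right (x : S) : monomial α 1 1 x = V α x := by
  simp [monomial]

/-- The *-subalgebra spanned by the monomials. -/
noncomputable def monomialSubalgebra : StarSubalgebra ℂ (CrossedProduct α) where
  carrier := Submodule.span ℂ (Set.range fun p : S × A × S => monomial α p.1 p.2.1 p.2.2)
  add_mem' := Submodule.add_mem _
  mul_mem' := by
    intro b c hb hc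
    rw [SetLike.mem_coe] at hb hc ⊢
    have h := Submodule.mul_mem_mul hb hc
    rw [Submodule.span_mul_span] at h
    refine Submodule.span_mono ?_ h
    rintro _ ⟨_, ⟨p, rfl⟩, _, ⟨q, rfl⟩, rfl⟩
    exact ⟨⟨_, _, _⟩, (monomial_mul α _ _ _ _ _ _).symm⟩
  algebraMap_mem' c := by
    rw [Algebra.algebraMap_eq_smul_one, ← map_one (ι α), ← monomial_one_one]
    exact Submodule.smul_mem _ _ (Submodule.subset_span ⟨(1, 1, 1), rfl⟩)
  star_mem' := by
    intro b hb
    rw [SetLike.mem_coe] at hb ⊢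
    induction hb using Submodule.span_induction with
    | mem b hb =>
      obtain ⟨p, rfl⟩ := hb
      exact Submodule.subset_span ⟨⟨_, _, _⟩, (star_monomial α _ _ _).symm⟩
    | zero => rw [star_zero]; exact Submodule.zero_mem _
    | add b c _ _ hb hc => rw [star_add]; exact Submodule.add_mem _ hb hc
    | smul c b _ hb => rw [star_smul]; exact Submodule.smul_mem _ _ hb

theorem continuous_starAlgEquiv {D : Type v} {E : Type w} [CStarAlgebra D] [CStarAlgebra E]
    (e : D ≃⋆ₐ[ℂ] E) : Continuous e :=
  (NonUnitalStarAlgHom.isometry (e : D →⋆ₐ[ℂ] E) e.injective).continuous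

variable {α} in
/-- A universal covariant pair generates: `D` maps into any closed unital *-subalgebra containing
the pair, and the composite with the inclusion is the identity. -/
theorem CovariantPair.dense_of_universal {D : Type w} [CStarAlgebra D] (p : CovariantPair α D)
    (hlift : ∀ (E : Type w) [CStarAlgebra E] (q : CovariantPair α E),
      ∃ f : D →⋆ₐ[ℂ] E, (∀ a, f (p.ι a) = q.ι a) ∧ ∀ x, f (p.v x) = q.v x)
    (hext : ∀ f : D →⋆ₐ[ℂ] D, (∀ a, f (p.ι a) = p.ι a) → (∀ x, f (p.v x) = p.v x) →
      ∀ b, f b = b)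
    (M : StarSubalgebra ℂ D) (hι : ∀ a, p.ι a ∈ M) (hv : ∀ x, p.v x ∈ M) :
    Dense (M : Set D) := by
  let T := M.topologicalClosure
  have : IsClosed (T : Set D) := M.isClosed_topologicalClosure
  have hT : M ≤ T := M.le_topologicalClosure
  obtain ⟨f, hfι, hfv⟩ := hlift T
    (p.codRestrict T (fun a => hT (hι a)) (fun x => hT (hv x)))
  have h := hext (T.subtype.comp f)
    (fun a => by rw [StarAlgHom.comp_apply, hfι]; rfl)
    (fun x => by rw [StarAlgHom.comp_apply, hfv]; rfl)
  intro b
  rw [← M.topologicalClosure_coe, ← h b]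
  exact (f b).2

theorem dense_span_monomial :
    Dense (Submodule.span ℂ (Set.range fun p : S × A × S => monomial α p.1 p.2.1 p.2.2) :
      Set (CrossedProduct α)) :=
  (canonicalPair α).dense_of_universal (fun _ _ q => exists_hom α q)
    (fun _ h1 h2 b => congrArg (fun g : CrossedProduct α →⋆ₐ[ℂ] CrossedProduct α => g b)
      (hom_ext α (g := StarAlgHom.id ℂ _) h1 h2))
    (monomialSubalgebra α)
    (fun a => Submodule.subset_span ⟨(1, a, 1), monomial_one_one α a⟩)
    (fun x => Submodule.subset_span ⟨(1, 1, x), monomial_one_one_right α x⟩)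

/-- Continuous linear functionals are determined by their values on monomials. -/
theorem functional_ext {φ ψ : CrossedProduct α →L[ℂ] ℂ}
    (h : ∀ x y a, φ (monomial α x a y) = ψ (monomial α x a y)) : φ = ψ :=
  ContinuousLinearMap.ext_on (dense_span_monomial α) (by
    rintro _ ⟨p, rfl⟩; exact h _ _ _)

/-! ### The dynamics on monomials -/

variable (N : S →* {r : ℝ // 0 < r})

/-- The entire function `z ↦ (N y / N x) ^ (i z) • monomial x a y`, which extends the orbit of a
monomial under the dynamics. -/
noncomputable def monomialOrbit (x : S) (a : A) (y : S) (z : ℂ) : CrossedProduct α :=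
  Complex.exp (z * Complex.I * ((Real.log (N y) - Real.log (N x) : ℝ) : ℂ)) • monomial α x a y

theorem dynamics_monomial (t : ℝ) (x y : S) (a : A) :
    dynamics α N t (monomial α x a y) = monomialOrbit α N x a y t := by
  have h : ∀ x : S, ((N x : ℝ) : ℂ) ^ ((t : ℂ) * Complex.I) =
      Complex.exp (Real.log (N x) * (t * Complex.I)) := fun x => by
    rw [Complex.cpow_def_of_ne_zero (Complex.ofReal_ne_zero.mpr (N x).2.ne'),
      Complex.ofReal_log (N x).2.le]
  rw [monomialOrbit, monomial, map_mul, map_mul, map_star, dynamics_V, dynamics_V, dynamics_ι,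
    star_smul, smul_mul_assoc, smul_mul_smul_comm, h, h, Complex.star_def, ← Complex.exp_conj,
    ← Complex.exp_add]
  congr 2
  simp only [map_mul, Complex.conj_ofReal, Complex.conj_I]
  push_cast
  ring

theorem isAnalyticExtension_monomial (x y : S) (a : A) :
    IsAnalyticExtension (dynamics α N) (monomial α x a y) (monomialOrbit α N x a y) := by
  refine ⟨?_, fun t => (dynamics_monomial α N t x y a).symm⟩
  unfold monomialOrbit
  fun_prop

theorem monomialOrbit_I_mul (β : ℝ) (x y : S) (a : A) :
    monomialOrbit α N x a y (Complex.I * β) =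
      ((((N x : ℝ) ^ β / (N y : ℝ) ^ β : ℝ)) : ℂ) • monomial α x a y := by
  rw [monomialOrbit, Real.rpow_def_of_pos (N x).2, Real.rpow_def_of_pos (N y).2, ← Real.exp_sub,
    Complex.ofReal_exp]
  congr 2
  push_cast
  linear_combination (β * ((Real.log (N y) : ℂ) - Real.log (N x))) * Complex.I_mul_I

theorem dynamics_zero (b : CrossedProduct α) : dynamics α N 0 b = b :=
  EquivLike.injective (dynamics α N 0) (by rw [← dynamics_add, add_zero])

theorem continuous_dynamics (t : ℝ) : Continuous (dynamics α N t) :=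
  continuous_starAlgEquiv _


theorem isAnalyticElement_monomial (x y : S) (a : A) :
    IsAnalyticElement (dynamics α N) (monomial α x a y) :=
  ⟨_, isAnalyticExtension_monomial α N x y a⟩

end

/-! ### KMS states and scaling traces -/

section

variable {A : Type u} [CStarAlgebra A] {S : Type v} [CancelCommMonoid S]
  (α : S →* (A →⋆ₙₐ[ℂ] A)) (N : S →* {r : ℝ // 0 < r}) (β : ℝ)

open Classical in
/-- The values which the state corresponding to the trace `τ` takes on monomials. -/
def TraceFormula (τ : A →L[ℂ] ℂ) (φ : CrossedProduct α →L[ℂ] ℂ) : Prop :=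
  ∀ (x y : S) (a : A), φ (monomial α x a y) =
    if x = y then (((N x : ℝ) ^ β : ℝ) : ℂ) * τ (a * α x 1) else 0

/-- The restriction of a functional to the coefficient algebra. -/
noncomputable def restrict (φ : CrossedProduct α →L[ℂ] ℂ) : A →L[ℂ] ℂ :=
  φ.comp ((ι α : A →ₗ[ℂ] CrossedProduct α).mkContinuous 1 fun a => by
    rw [one_mul]; exact NonUnitalStarAlgHom.norm_apply_le (ι α) a)

theorem restrict_apply (φ : CrossedProduct α →L[ℂ] ℂ) (a : A) :
    restrict α φ a = φ (ι α a) := rfl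

variable {α N β}

theorem rpow_ne_zero (x : S) : (N x : ℝ) ^ β ≠ 0 := (Real.rpow_pos_of_pos (N x).2 β).ne'

theorem rpow_map_mul (x y : S) : (N (x * y) : ℝ) ^ β = (N x : ℝ) ^ β * (N y : ℝ) ^ β := by
  rw [map_mul, Positive.val_mul, Real.mul_rpow (N x).2.le (N y).2.le]

theorem ScalingTraces.eq_rpow_mul {τ : A →L[ℂ] ℂ} (hτ : τ ∈ ScalingTraces α N β) (s : S) (a : A) :
    τ a = (((N s : ℝ) ^ β : ℝ) : ℂ) * τ (α s a) := by
  rw [hτ.2, ← mul_assoc, ← Complex.ofReal_mul, ← Real.rpow_add (N s).2, add_neg_cancel,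
    Real.rpow_zero, Complex.ofReal_one, one_mul]

theorem IsKMSState.monomial_mul_monomial {φ : CrossedProduct α →L[ℂ] ℂ}
    (hφ : IsKMSState (dynamics α N) β φ) (x y z w : S) (a b : A) :
    φ (monomial α x a y * monomial α z b w) =
      (((N x : ℝ) ^ β / (N y : ℝ) ^ β : ℝ) : ℂ) * φ (monomial α z b w * monomial α x a y) := by
  rw [hφ.2.2 _ _ _ (isAnalyticExtension_monomial α N x y a)
    (isAnalyticElement_monomial α N z w b), monomialOrbit_I_mul, mul_smul_comm, map_smul,
    smul_eq_mul]

/-- An invariant functional vanishes on a monomial with `x ≠ y`: for a suitable `t` the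
eigenvalue of `σ_t` is `-1`. -/
theorem IsKMSState.monomial_eq_zero (hN : Function.Injective N) {φ : CrossedProduct α →L[ℂ] ℂ}
    (hφ : IsKMSState (dynamics α N) β φ) {x y : S} (hxy : x ≠ y) (a : A) :
    φ (monomial α x a y) = 0 := by
  have hd : Real.log (N y) - Real.log (N x) ≠ 0 := fun h => hxy (hN (Subtype.ext
    (Real.log_injOn_pos (N x).2 (N y).2 (sub_eq_zero.mp h).symm)))
  have h := hφ.2.1 (Real.pi / (Real.log (N y) - Real.log (N x))) (monomial α x a y)
  have hd' : ((Real.log (N y) - Real.log (N x) : ℝ) : ℂ) ≠ 0 := Complex.ofReal_ne_zero.mpr hd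
  rw [dynamics_monomial, monomialOrbit, Complex.ofReal_div, div_mul_eq_mul_div,
    div_mul_cancel₀ _ hd', Complex.exp_pi_mul_I, neg_one_smul, map_neg] at h
  exact self_eq_neg.mp h.symm

theorem IsKMSState.traceFormula (hN : Function.Injective N) {φ : CrossedProduct α →L[ℂ] ℂ}
    (hφ : IsKMSState (dynamics α N) β φ) : TraceFormula α N β (restrict α φ) φ := by
  intro x y a
  split_ifs with hxy
  · subst hxy
    have h := hφ.monomial_mul_monomial x 1 1 x 1 a
    have h1 : monomial α x 1 1 * monomial α 1 a x = monomial α x a x := by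
      rw [monomial_mul]; simp
    have h2 : monomial α 1 a x * monomial α x 1 1 = ι α (a * α x 1) := by
      simp only [monomial, map_one, star_one, one_mul, mul_one, mul_assoc]
      rw [V_mul_star_V_self, ← map_mul]
    rw [h1, h2] at h
    simpa [restrict_apply] using h
  · exact hφ.monomial_eq_zero hN hxy a

theorem IsKMSState.isTracialState {φ : CrossedProduct α →L[ℂ] ℂ}
    (hφ : IsKMSState (dynamics α N) β φ) : IsTracialState (restrict α φ) := by
  refine ⟨⟨fun b => ?_, ?_⟩, fun a b => ?_⟩
  · rw [restrict_apply, map_mul, map_star]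
    exact hφ.1.1 _
  · rw [restrict_apply, map_one]
    exact hφ.1.2
  · have h := hφ.monomial_mul_monomial 1 1 1 1 a b
    simpa [restrict_apply, monomial_one_one] using h

theorem IsKMSState.scaling {φ : CrossedProduct α →L[ℂ] ℂ}
    (hφ : IsKMSState (dynamics α N) β φ) (x : S) (a : A) :
    restrict α φ (α x a) = (((N x : ℝ) ^ (-β) : ℝ) : ℂ) * restrict α φ a := by
  have h := hφ.monomial_mul_monomial 1 x x 1 1 (α x a)
  have h1 : monomial α 1 1 x * monomial α x (α x a) 1 = ι α (α x a) := by
    rw [monomial_one_one_right, monomial, map_one, mul_one, ← mul_assoc, V_mul_star_V_self,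
      ← map_mul, ← map_mul, one_mul]
  have h2 : monomial α x (α x a) 1 * monomial α 1 1 x = ι α a := by
    rw [monomial_one_one_right, monomial, map_one, mul_one, ← ι_mul_star_V, mul_assoc,
      star_V_mul_V, mul_one]
  rw [h1, h2] at h
  simpa [restrict_apply, Real.rpow_neg (N x).2.le] using h

theorem IsKMSState.restrict_mem {φ : CrossedProduct α →L[ℂ] ℂ}
    (hφ : IsKMSState (dynamics α N) β φ) : restrict α φ ∈ ScalingTraces α N β :=
  ⟨hφ.isTracialState, hφ.scaling⟩

/-- The KMS condition with the dynamics moved to a monomial, where it is a scalar. In this form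
both sides are continuous in the other element `c`, which need not be analytic. -/
theorem TraceFormula.monomial_mul_comm {τ : A →L[ℂ] ℂ} (hτ : τ ∈ ScalingTraces α N β)
    {φ : CrossedProduct α →L[ℂ] ℂ} (h : TraceFormula α N β τ φ) (z w : S) (b : A)
    (c : CrossedProduct α) :
    φ (c * monomial α z b w) =
      (((N w : ℝ) ^ β / (N z : ℝ) ^ β : ℝ) : ℂ) * φ (monomial α z b w * c) := by
  suffices hs : φ.comp ((ContinuousLinearMap.mul ℂ _).flip (monomial α z b w)) =
      (((N w : ℝ) ^ β / (N z : ℝ) ^ β : ℝ) : ℂ) •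
        φ.comp (ContinuousLinearMap.mul ℂ _ (monomial α z b w)) from
    congrArg (fun f => f c) hs
  apply functional_ext
  intro x y a
  change φ (monomial α x a y * monomial α z b w) =
    (((N w : ℝ) ^ β / (N z : ℝ) ^ β : ℝ) : ℂ) * φ (monomial α z b w * monomial α x a y)
  rw [monomial_mul, monomial_mul, h, h]
  by_cases hxy : z * x = y * w
  · have hxy' : x * z = w * y := by rw [mul_comm, hxy, mul_comm]
    rw [if_pos hxy, if_pos hxy']
    have hscale := ScalingTraces.eq_rpow_mul hτ
    -- Both traces are computed at a common multiple, where they agree up to a cyclic permutation.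
    rw [hscale w (_ * _), hscale z (α x b * _ * _ * _), rpow_map_mul, rpow_map_mul]
    simp only [map_mul (α _), ← action_mul]
    have e1 : w * z = z * w := mul_comm w z
    have e2 : w * y = z * x := by rw [mul_comm, hxy]
    have e3 : w * (y * z) = z * (x * z) := by rw [← mul_assoc, e2, mul_assoc]
    have e4 : w * (z * x) = z * (w * x) := mul_left_comm _ _ _
    rw [e1, e2, e3, e4, mul_assoc (α (z * w) a * _), hτ.1.2]
    simp only [← mul_assoc]
    have hz : (((N z : ℝ) ^ β : ℝ) : ℂ) ≠ 0 := Complex.ofReal_ne_zero.mpr (rpow_ne_zero z)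
    push_cast
    field_simp
  · have hxy' : x * z ≠ w * y := fun e => hxy (by rw [mul_comm, e, mul_comm])
    rw [if_neg hxy, if_neg hxy', mul_zero]

/-- If `F` extends the orbit of `b` and `m` is a monomial, then invariance of `φ` identifies
`z ↦ φ (m * F z)` with an explicit exponential on the real line. By the identity theorem they agree
at `i β`, which together with `TraceFormula.monomial_mul_comm` is the KMS condition. -/
theorem TraceFormula.isKMSState {τ : A →L[ℂ] ℂ} (hτ : τ ∈ ScalingTraces α N β)
    {φ : CrossedProduct α →L[ℂ] ℂ} (hφ : IsState φ) (h : TraceFormula α N β τ φ) :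
    IsKMSState (dynamics α N) β φ := by
  have hinv : ∀ (t : ℝ) (b : CrossedProduct α), φ (dynamics α N t b) = φ b := by
    intro t b
    let f : CrossedProduct α →L[ℂ] CrossedProduct α :=
      ⟨((dynamics α N t : CrossedProduct α →⋆ₐ[ℂ] CrossedProduct α) :
        CrossedProduct α →ₗ[ℂ] CrossedProduct α), continuous_dynamics α N t⟩
    suffices hs : φ.comp f = φ from congrArg (fun g => g b) hs
    apply functional_ext
    intro x y a
    change φ (dynamics α N t (monomial α x a y)) = _
    rw [dynamics_monomial, monomialOrbit, map_smul, h]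
    split_ifs with hxy
    · subst hxy; simp
    · simp
  refine ⟨hφ, hinv, fun b c F hF _ => ?_⟩
  suffices hs : φ.comp (ContinuousLinearMap.mul ℂ _ b) =
      φ.comp ((ContinuousLinearMap.mul ℂ _).flip (F (Complex.I * β))) from
    congrArg (fun f => f c) hs
  apply functional_ext
  intro x y a
  change φ (b * monomial α x a y) = φ (monomial α x a y * F (Complex.I * β))
  set m := monomial α x a y with hm
  let d : ℝ := Real.log (N y) - Real.log (N x)
  let g : ℂ → ℂ := fun z => φ (m * F z)
  let k : ℂ → ℂ := fun z => Complex.exp (-z * Complex.I * d) * φ (m * b)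
  have hg : Differentiable ℂ g := by
    have := hF.1
    exact φ.differentiable.comp ((differentiable_const m).mul this)
  have hk : Differentiable ℂ k := by fun_prop
  have hreal : ∀ t : ℝ, g t = k t := by
    intro t
    have e : dynamics α N (-t) (dynamics α N t b) = b := by
      rw [← dynamics_add, neg_add_cancel]
      exact dynamics_zero α N b
    change φ (m * F t) = _
    rw [hF.2, ← hinv (-t), map_mul, e, hm, dynamics_monomial, monomialOrbit, smul_mul_assoc,
      map_smul, smul_eq_mul, Complex.ofReal_neg]
  have hgk : g = k := by
    refine AnalyticOnNhd.eq_of_frequently_eq (z₀ := 0)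
      (fun z _ => hg.analyticAt z) (fun z _ => hk.analyticAt z) ?_
    have ht : Filter.Tendsto (fun t : ℝ => (t : ℂ)) (nhdsWithin 0 {0}ᶜ) (nhdsWithin 0 {0}ᶜ) :=
      tendsto_nhdsWithin_of_tendsto_nhds_of_eventually_within _
        (Complex.continuous_ofReal.tendsto' 0 0 Complex.ofReal_zero |>.mono_left
          nhdsWithin_le_nhds)
        (by filter_upwards [self_mem_nhdsWithin] with t ht using Complex.ofReal_ne_zero.mpr ht)
    exact ht.frequently (Filter.Frequently.of_forall hreal)
  have := congrFun hgk (Complex.I * β)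
  change φ (m * F (Complex.I * β)) = _ at this
  rw [this, h.monomial_mul_comm hτ]
  change _ = Complex.exp _ * _
  congr 1
  rw [Real.rpow_def_of_pos (N x).2, Real.rpow_def_of_pos (N y).2, ← Real.exp_sub,
    Complex.ofReal_exp]
  congr 1
  simp only [d]
  push_cast
  linear_combination (β * ((Real.log (N y) : ℂ) - Real.log (N x))) * Complex.I_mul_I

end

/-! ### Hilbert spaces from positive semidefinite forms -/

/-- Separation and completion of a positive semidefinite form. -/
theorem exists_hilbertSpace_of_core {E : Type u} [AddCommGroup E] [Module ℂ E]
    (c : PreInnerProductSpace.Core ℂ E) :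
    ∃ (H : Type u) (_ : NormedAddCommGroup H) (_ : InnerProductSpace ℂ H) (_ : CompleteSpace H)
      (j : E →ₗ[ℂ] H), DenseRange j ∧ ∀ f g, inner ℂ (j f) (j g) = c.inner f g := by
  let : SeminormedAddCommGroup E := InnerProductSpace.Core.toSeminormedAddCommGroup (c := c)
  let : InnerProductSpace ℂ E := InnerProductSpace.ofCore c
  refine ⟨UniformSpace.Completion E, inferInstance, inferInstance, inferInstance,
    (UniformSpace.Completion.toComplL : E →L[ℂ] UniformSpace.Completion E),
    UniformSpace.Completion.denseRange_coe, fun f g => ?_⟩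
  exact UniformSpace.Completion.inner_coe f g

theorem exists_operator_of_bound {E : Type u} [AddCommGroup E] [Module ℂ E] {H : Type v}
    [NormedAddCommGroup H] [InnerProductSpace ℂ H] [CompleteSpace H] {j : E →ₗ[ℂ] H}
    (hj : DenseRange j) (T : E →ₗ[ℂ] E) (h : ∃ C : ℝ, ∀ f, ‖j (T f)‖ ≤ C * ‖j f‖) :
    ∃ T' : H →L[ℂ] H, ∀ f, T' (j f) = j (T f) :=
  ⟨(j ∘ₗ T).extendOfNorm j, LinearMap.extendOfNorm_eq (f := j ∘ₗ T) hj h⟩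

/-- Algebraic form of a covariant representation: operators on a vector space with a positive
semidefinite form `B` which satisfy the relations of a covariant pair up to the null space of `B`.
The operator `W' x` is a formal adjoint of `W x`. -/
theorem exists_covariantPair_of_form {A : Type u} [CStarAlgebra A] {S : Type v}
    [CancelCommMonoid S] (α : S →* (A →⋆ₙₐ[ℂ] A)) {E : Type w} [AddCommGroup E] [Module ℂ E]
    (c : PreInnerProductSpace.Core ℂ E) (P : A →ₗ[ℂ] E →ₗ[ℂ] E) (W W' : S → E →ₗ[ℂ] E)
    (hP_star : ∀ a f g, c.inner (P a f) g = c.inner f (P (star a) g))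
    (hP_mul : ∀ a b f g, c.inner f (P (a * b) g) = c.inner f (P a (P b g)))
    (hP_one : ∀ f g, c.inner f (P 1 g) = c.inner f g)
    (hW_adj : ∀ x f g, c.inner (W x f) g = c.inner f (W' x g))
    (hW_iso : ∀ x f g, c.inner f (W' x (W x g)) = c.inner f g)
    (hW_mul : ∀ x y f g, c.inner f (W (x * y) g) = c.inner f (W x (W y g)))
    (hW_one : ∀ f g, c.inner f (W 1 g) = c.inner f g)
    (hcov : ∀ x a f g, c.inner f (W x (P a (W' x g))) = c.inner f (P (α x a) g)) :
    ∃ (H : Type w) (_ : NormedAddCommGroup H) (_ : InnerProductSpace ℂ H) (_ : CompleteSpace H)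
      (j : E →ₗ[ℂ] H) (p : CovariantPair α (H →L[ℂ] H)),
      (∀ f g, inner ℂ (j f) (j g) = c.inner f g) ∧ (∀ a f, p.ι a (j f) = j (P a f)) ∧
        ∀ x f, p.v x (j f) = j (W x f) := by
  obtain ⟨H, i1, i2, i3, j, hj, hin⟩ := exists_hilbertSpace_of_core c
  have hext : ∀ f g, (∀ h, c.inner h f = c.inner h g) → j f = j g := fun f g h =>
    hj.eq_of_inner_right ℂ fun h' => by rw [hin, hin, h]
  have hop : ∀ T T' : H →L[ℂ] H, (∀ f, T (j f) = T' (j f)) → T = T' := fun T T' h =>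
    ContinuousLinearMap.coeFn_injective (hj.equalizer T.continuous T'.continuous (funext h))
  have hnorm : ∀ f, ‖j f‖ ^ 2 = (c.inner f f).re := fun f => by
    rw [← hin, ← inner_self_eq_norm_sq (𝕜 := ℂ)]; rfl
  have hPb : ∀ a, ∃ C : ℝ, ∀ f, ‖j (P a f)‖ ≤ C * ‖j f‖ := by
    intro a
    refine ⟨‖a‖, fun f => ?_⟩
    let := CStarAlgebra.spectralOrder A
    have := CStarAlgebra.spectralOrderedRing A
    -- A square root of `‖a‖ ^ 2 - a^* a` turns the bound into positivity of the form.
    obtain ⟨d, hd⟩ := CStarAlgebra.nonneg_iff_eq_star_mul_self.mp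
      (sub_nonneg.mpr (CStarAlgebra.star_mul_le_algebraMap_norm_sq (a := a)))
    have hsq : ∀ b, ((‖j (P b f)‖ ^ 2 : ℝ) : ℂ) = inner ℂ (j f) (j (P (star b * b) f)) :=
      fun b => by
        rw [hin, hP_mul, ← hP_star, ← hin, inner_self_eq_norm_sq_to_K]
        push_cast
        rfl
    have h1 : ((‖j (P d f)‖ ^ 2 : ℝ) : ℂ) = ((‖a‖ ^ 2 * ‖j f‖ ^ 2 - ‖j (P a f)‖ ^ 2 : ℝ) : ℂ) := by
      rw [hsq, ← hd, Complex.ofReal_sub, hsq, map_sub, LinearMap.sub_apply, map_sub,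
        inner_sub_right, IsScalarTower.algebraMap_apply ℝ ℂ A, Algebra.algebraMap_eq_smul_one,
        map_smul, LinearMap.smul_apply, map_smul, inner_smul_right, hin f (P 1 f), hP_one, ← hin,
        inner_self_eq_norm_sq_to_K]
      push_cast
      rfl
    have h2 := Complex.ofReal_injective h1
    refine le_of_sq_le_sq ?_ (by positivity)
    rw [mul_pow]
    linarith [sq_nonneg ‖j (P d f)‖]
  have hWb : ∀ x, ∃ C : ℝ, ∀ f, ‖j (W x f)‖ ≤ C * ‖j f‖ := fun x => ⟨1, fun f => by
    rw [one_mul]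
    refine (pow_le_pow_iff_left₀ (norm_nonneg _) (norm_nonneg _) two_ne_zero).mp ?_
    rw [hnorm, hnorm, hW_adj, hW_iso]⟩
  choose π hπ using fun a => exists_operator_of_bound hj (P a) (hPb a)
  choose V hV using fun x => exists_operator_of_bound hj (W x) (hWb x)
  have hVs : ∀ x f, star (V x) (j f) = j (W' x f) := by
    intro x f
    refine hj.eq_of_inner_right ℂ fun h => ?_
    rw [ContinuousLinearMap.star_eq_adjoint, ContinuousLinearMap.adjoint_inner_right, hV, hin, hin,
      hW_adj]
  let p : CovariantPair α (H →L[ℂ] H) :=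
    { ι :=
        { toFun := π
          map_one' := hop _ _ fun f => by rw [hπ]; exact hext _ _ fun h => hP_one h f
          map_mul' := fun a b => hop _ _ fun f => by
            rw [hπ, mul_apply_eq_comp, hπ, hπ]; exact hext _ _ fun h => hP_mul a b h f
          map_zero' := hop _ _ fun f => by rw [hπ, map_zero]; simp
          map_add' := fun a b => hop _ _ fun f => by
            rw [hπ, map_add]; simp [hπ]
          commutes' := fun r => hop _ _ fun f => by
            rw [hπ, Algebra.algebraMap_eq_smul_one, map_smul, LinearMap.smul_apply, map_smul,
              hext _ _ fun h => hP_one h f, Algebra.algebraMap_eq_smul_one]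
            rfl
          map_star' := fun a => hop _ _ fun f => hj.eq_of_inner_right ℂ fun h => by
            rw [ContinuousLinearMap.star_eq_adjoint, ContinuousLinearMap.adjoint_inner_right, hπ,
              hπ, hin, hin, hP_star] }
      v :=
        { toFun := V
          map_one' := hop _ _ fun f => by rw [hV]; exact hext _ _ fun h => hW_one h f
          map_mul' := fun x y => hop _ _ fun f => by
            rw [hV, mul_apply_eq_comp, hV, hV]
            exact hext _ _ fun h => hW_mul x y h f }
      isometry := fun x => hop _ _ fun f => by
        change star (V x) (V x (j f)) = j f
        rw [hV, hVs]
        exact hext _ _ fun h => hW_iso x h f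
      covariance := fun x a => hop _ _ fun f => by
        change V x (π a (star (V x) (j f))) = π (α x a) (j f)
        rw [hVs, hπ, hV, hπ]
        exact hext _ _ fun h => hcov x a h f }
  exact ⟨H, i1, i2, i3, j, p, hin, hπ, hV⟩

/-! ### The representation attached to a scaling trace -/

section

theorem IsState.map_star {B : Type w} [CStarAlgebra B] {φ : B →L[ℂ] ℂ} (hφ : IsState φ) (b : B) :
    φ (star b) = star (φ b) := by
  -- Polarization: `φ` is real at `(1 + b)^* (1 + b)` and at `(1 + i b)^* (1 + i b)`.
  have h0 := (Complex.nonneg_iff.mp (hφ.1 b)).2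
  have h1 := (Complex.nonneg_iff.mp (hφ.1 (1 + b))).2
  have h2 := (Complex.nonneg_iff.mp (hφ.1 (1 + Complex.I • b))).2
  simp only [star_add, star_one, star_smul, add_mul, mul_add, one_mul, mul_one, smul_mul_assoc,
    mul_smul_comm, map_add, map_smul, hφ.2, smul_eq_mul, Complex.star_def, Complex.conj_I,
    Complex.add_im, Complex.mul_im, Complex.neg_im, Complex.neg_re, Complex.I_re, Complex.I_im,
    Complex.one_im, Complex.mul_re] at h1 h2
  apply Complex.ext
  · rw [Complex.star_def, Complex.conj_re]
    linarith
  · rw [Complex.star_def, Complex.conj_im]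
    linarith

variable {A : Type u} [CStarAlgebra A] {S : Type v} [CancelCommMonoid S]
  (α : S →* (A →⋆ₙₐ[ℂ] A)) {G : Type w} [CommGroup G] (N : S →* G) (ρ : G →* {r : ℝ // 0 < r})
  (τ : A →L[ℂ] ℂ)

theorem star_action_unit (x : S) : star (α x 1) = α x 1 := by rw [← map_star, star_one]

open Classical in
/-- The vector `single (g, x) a` stands for `α_x⁻¹ (a) ⊗ δ_g`, cut down by the unit of `A`, in the
tensor product of the `L²`-space of the dilated trace with `ℓ²(G)`. The component at `g` is weighted
by `ρ g`, so that the isometries act without a normalizing scalar. This is the inner product of two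
such vectors, transported to `A` by `α (x * z)`. -/
noncomputable def kernel (p q : G × S) : A →ₗ⋆[ℂ] A →ₗ[ℂ] ℂ :=
  LinearMap.mk₂'ₛₗ _ _
    (fun a b => if p.1 = q.1 then ((ρ p.1 * ρ (N (p.2 * q.2)) : ℝ) : ℂ) *
      τ (star (α q.2 a) * α (p.2 * q.2) 1 * α p.2 b) else 0)
    (fun a a' b => by split_ifs <;> simp [add_mul, mul_add])
    (fun c a b => by split_ifs <;> simp [mul_left_comm])
    (fun a b b' => by split_ifs <;> simp [mul_add])
    (fun c a b => by split_ifs <;> simp [mul_left_comm])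

/-- The form on finitely supported families given by `kernel`. -/
noncomputable def form : (G × S →₀ A) →ₗ⋆[ℂ] (G × S →₀ A) →ₗ[ℂ] ℂ :=
  Finsupp.lsum ℂ fun p => (Finsupp.lsum ℂ fun q => (kernel α N ρ τ p q).flip).flip

theorem form_single_single (p q : G × S) (a b : A) :
    form α N ρ τ (Finsupp.single p a) (Finsupp.single q b) = kernel α N ρ τ p q a b := by
  simp [form]

theorem form_apply (f h : G × S →₀ A) :
    form α N ρ τ f h = ∑ p ∈ f.support, ∑ q ∈ h.support, kernel α N ρ τ p q (f p) (h q) := by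
  simp [form, Finsupp.lsum_apply, Finsupp.sum, LinearMap.sum_apply]

theorem kernel_of_ne {p q : G × S} (h : p.1 ≠ q.1) (a b : A) : kernel α N ρ τ p q a b = 0 := by
  simp [kernel, h]

theorem kernel_same (g : G) (x z : S) (a b : A) :
    kernel α N ρ τ (g, x) (g, z) a b = ((ρ g * ρ (N (x * z)) : ℝ) : ℂ) *
      τ (star (α z a) * α (x * z) 1 * α x b) := by
  simp [kernel]

variable {α N ρ τ} (hτ : IsTracialState τ) (hs : ∀ x a, τ a = ((ρ (N x) : ℝ) : ℂ) * τ (α x a))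

include hs in
/-- The kernel can be computed at any common multiple of the two indices. -/
theorem kernel_common (g : G) {x z X c d : S} (hx : c * x = X) (hz : d * z = X) (a b : A) :
    kernel α N ρ τ (g, x) (g, z) a b = ((ρ g * ρ (N X) : ℝ) : ℂ) *
      τ (star (α c a) * α X 1 * α d b) := by
  rw [kernel_same, hs (c * d) (_ * _ * _), hs X (_ * _ * _)]
  simp only [map_mul (α _), map_star, ← action_mul]
  have e1 : c * d * z = X * c := by rw [mul_assoc, hz, mul_comm]
  have e2 : c * d * x = X * d := by rw [mul_right_comm, hx]
  have e3 : c * d * (x * z) = X * X := by rw [mul_mul_mul_comm, hx, hz]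
  rw [e1, e2, e3]
  have e4 : (ρ (N (x * z)) : ℝ) * ρ (N (c * d)) = ρ (N X) * ρ (N X) := by
    rw [← Positive.val_mul, ← Positive.val_mul, ← map_mul, ← map_mul, ← map_mul, ← map_mul,
      mul_comm (x * z), e3]
  have e5 : ((ρ (N (x * z)) : ℝ) : ℂ) * ((ρ (N (c * d)) : ℝ) : ℂ) =
      ((ρ (N X) : ℝ) : ℂ) * ((ρ (N X) : ℝ) : ℂ) := by exact_mod_cast e4
  push_cast
  linear_combination (((ρ g : ℝ) : ℂ) * τ (star (α (X * c) a) * α (X * X) 1 * α (X * d) b)) * e5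

include hτ in
theorem kernel_conj_symm (p q : G × S) (a b : A) :
    star (kernel α N ρ τ q p b a) = kernel α N ρ τ p q a b := by
  by_cases h : p.1 = q.1
  · obtain ⟨g, x⟩ := p
    obtain ⟨g', z⟩ := q
    obtain rfl : g = g' := h
    rw [kernel_same, kernel_same, star_mul', ← hτ.1.map_star, mul_comm z x]
    simp only [star_mul, star_star, star_action_unit, mul_assoc]
    simp
  · rw [kernel_of_ne _ _ _ _ h, kernel_of_ne _ _ _ _ (Ne.symm h), star_zero]

include hτ in
theorem form_conj_symm (f h : G × S →₀ A) : star (form α N ρ τ h f) = form α N ρ τ f h := by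
  rw [form_apply, form_apply, Finset.sum_comm, star_sum]
  refine Finset.sum_congr rfl fun p _ => ?_
  rw [star_sum]
  exact Finset.sum_congr rfl fun q _ => kernel_conj_symm hτ _ _ _ _

theorem exists_common_multiple {I : Type*} (F : Finset I) (x : I → S) :
    ∃ (X : S) (c : I → S), ∀ i ∈ F, c i * x i = X := by
  classical
  exact ⟨∏ i ∈ F, x i, fun i => ∏ k ∈ F.erase i, x k, fun i hi => Finset.prod_erase_mul _ _ hi⟩

include hτ hs in
/-- After moving a family to a common multiple of its indices, its component at each `g : G` is
represented by one element of `A`. -/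
theorem form_self_nonneg (f : G × S →₀ A) : 0 ≤ form α N ρ τ f f := by
  classical
  obtain ⟨X, c, hX⟩ := exists_common_multiple f.support Prod.snd
  let t : G → A := fun g => ∑ p ∈ f.support with p.1 = g, α (c p) (f p)
  have h : form α N ρ τ f f = ∑ g ∈ f.support.image Prod.fst,
      ((ρ g * ρ (N X) : ℝ) : ℂ) * τ (star (t g) * α X 1 * t g) := by
    rw [form_apply, ← Finset.sum_fiberwise_of_maps_to
      (fun p hp => Finset.mem_image_of_mem Prod.fst hp)]
    refine Finset.sum_congr rfl fun g _ => ?_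
    have h1 : ∀ p ∈ f.support.filter (fun p => p.1 = g),
        ∑ q ∈ f.support, kernel α N ρ τ p q (f p) (f q) = ∑ q ∈ f.support with q.1 = g,
          ((ρ g * ρ (N X) : ℝ) : ℂ) * τ (star (α (c p) (f p)) * α X 1 * α (c q) (f q)) := by
      intro p hp
      obtain ⟨hp, hpg⟩ := Finset.mem_filter.mp hp
      rw [Finset.sum_filter]
      refine Finset.sum_congr rfl fun q hq => ?_
      split_ifs with hqg
      · have := kernel_common hs g (hX p hp) (hX q hq) (f p) (f q)
        rwa [← hpg, Prod.mk.eta, hpg, ← hqg, Prod.mk.eta, hqg] at this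
      · exact kernel_of_ne _ _ _ _ (fun e => hqg (e ▸ hpg)) _ _
    rw [Finset.sum_congr rfl h1]
    simp only [t, star_sum, Finset.sum_mul, Finset.mul_sum, map_sum]
    rw [Finset.sum_comm]
  rw [h]
  refine Finset.sum_nonneg fun g _ => mul_nonneg ?_ ?_
  · exact_mod_cast (mul_pos (ρ g).2 (ρ (N X)).2).le
  · have e : star (t g) * α X 1 * t g = star (α X 1 * t g) * (α X 1 * t g) := by
      rw [star_mul, star_action_unit, mul_assoc, mul_assoc, ← mul_assoc (α X 1) (α X 1), ← map_mul,
        one_mul]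
    rw [e]
    exact hτ.1.1 _

/-- The positive semidefinite form `form` as an inner product. -/
@[reducible] noncomputable def formCore : PreInnerProductSpace.Core ℂ (G × S →₀ A) where
  inner f h := form α N ρ τ f h
  conj_inner_symm f h := form_conj_symm hτ f h
  re_inner_nonneg f := (Complex.nonneg_iff.mp (form_self_nonneg hτ hs f)).1
  add_left f f' h := by simp
  smul_left f h c := by simp

end

section

variable {A : Type u} [CStarAlgebra A] {S : Type v} [CancelCommMonoid S]
  (α : S →* (A →⋆ₙₐ[ℂ] A)) {G : Type w}

/-- The operator by which `a : A` acts: `α_x⁻¹ (b) ⊗ δ_g ↦ a α_x⁻¹ (b) ⊗ δ_g`. -/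
noncomputable def leftMul : A →ₗ[ℂ] (G × S →₀ A) →ₗ[ℂ] (G × S →₀ A) where
  toFun a := Finsupp.lsum ℂ fun p => (Finsupp.lsingle p).comp (LinearMap.mulLeft ℂ (α p.2 a))
  map_add' a a' := by ext p b : 2; simp [add_mul]
  map_smul' c a := by ext p b : 2; simp

theorem leftMul_single (a : A) (g : G) (x : S) (b : A) :
    leftMul α a (Finsupp.single (g, x) b) = Finsupp.single (g, x) (α x a * b) := by
  simp [leftMul]

variable [CommGroup G] (N : S →* G)

/-- The operator by which the isometry of `s : S` acts:
`α_x⁻¹ (b) ⊗ δ_g ↦ α_s (α_x⁻¹ (b)) ⊗ δ_(s g)`, cut down by `α_s (1)`. -/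
noncomputable def shift (s : S) : (G × S →₀ A) →ₗ[ℂ] (G × S →₀ A) :=
  Finsupp.lsum ℂ fun p => (Finsupp.lsingle (N s * p.1, p.2)).comp
    ((LinearMap.mulLeft ℂ (α (s * p.2) 1)).comp (α s : A →ₗ[ℂ] A))

/-- The formal adjoint of `shift`: `α_x⁻¹ (b) ⊗ δ_g ↦ α_(s x)⁻¹ (b) ⊗ δ_(s⁻¹ g)`. -/
noncomputable def backShift (s : S) : (G × S →₀ A) →ₗ[ℂ] (G × S →₀ A) :=
  Finsupp.lsum ℂ fun p => Finsupp.lsingle ((N s)⁻¹ * p.1, s * p.2)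

theorem shift_single (s : S) (g : G) (x : S) (b : A) :
    shift α N s (Finsupp.single (g, x) b) =
      Finsupp.single (N s * g, x) (α (s * x) 1 * α s b) := by
  simp [shift]

theorem backShift_single (s : S) (g : G) (x : S) (b : A) :
    backShift N s (Finsupp.single (g, x) b) = Finsupp.single ((N s)⁻¹ * g, s * x) b := by
  simp [backShift]

variable {α N} {ρ : G →* {r : ℝ // 0 < r}} {τ : A →L[ℂ] ℂ}

theorem form_adjoint_of_single {T T' : (G × S →₀ A) →ₗ[ℂ] (G × S →₀ A)}
    (h : ∀ g x a g' z b, form α N ρ τ (T (Finsupp.single (g, x) a)) (Finsupp.single (g', z) b) =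
      form α N ρ τ (Finsupp.single (g, x) a) (T' (Finsupp.single (g', z) b)))
    (f k : G × S →₀ A) : form α N ρ τ (T f) k = form α N ρ τ f (T' k) := by
  induction f using Finsupp.induction_linear with
  | zero => simp
  | add f f' hf hf' => simp only [map_add, LinearMap.add_apply, hf, hf']
  | single p a =>
    induction k using Finsupp.induction_linear with
    | zero => simp
    | add k k' hk hk' => simp only [map_add, hk, hk']
    | single q b => exact h _ _ _ _ _ _

theorem form_congr_of_single {T T' : (G × S →₀ A) →ₗ[ℂ] (G × S →₀ A)}
    (h : ∀ g x b f, form α N ρ τ f (T (Finsupp.single (g, x) b)) =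
      form α N ρ τ f (T' (Finsupp.single (g, x) b)))
    (f k : G × S →₀ A) : form α N ρ τ f (T k) = form α N ρ τ f (T' k) := by
  induction k using Finsupp.induction_linear with
  | zero => simp
  | add k k' hk hk' => simp only [map_add, hk, hk']
  | single q b => exact h _ _ _ _

/-- To show that two vectors supported at the same `g` agree modulo the null space of the form, it
suffices to pair them with vectors supported at `g`. -/
theorem form_single_right_congr {p q : G × S} {b c : A} (hpq : p.1 = q.1)
    (h : ∀ z a, kernel α N ρ τ (p.1, z) p a b = kernel α N ρ τ (p.1, z) q a c)
    (f : G × S →₀ A) : form α N ρ τ f (Finsupp.single p b) =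
      form α N ρ τ f (Finsupp.single q c) := by
  induction f using Finsupp.induction_linear with
  | zero => simp
  | add f f' hf hf' => simp only [map_add, LinearMap.add_apply, hf, hf']
  | single r a =>
    rw [form_single_single, form_single_single]
    by_cases hr : r.1 = p.1
    · have := h r.2 a
      rwa [← hr] at this
    · rw [kernel_of_ne _ _ _ _ hr, kernel_of_ne _ _ _ _ (hpq ▸ hr)]

/-- Vectors are cut down by the unit of `A`. -/
theorem form_single_unit_mul (f : G × S →₀ A) (g : G) (x : S) (b : A) :
    form α N ρ τ f (Finsupp.single (g, x) (α x 1 * b)) =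
      form α N ρ τ f (Finsupp.single (g, x) b) := by
  refine form_single_right_congr rfl (fun z a => ?_) f
  rw [kernel_same, kernel_same, map_mul (α z), ← action_mul, mul_assoc,
    ← mul_assoc (α (z * x) 1) (α (z * x) 1), ← map_mul (α (z * x)), one_mul, ← mul_assoc]

variable (hs : ∀ x a, τ a = ((ρ (N x) : ℝ) : ℂ) * τ (α x a))

include hs in
/-- `α_(s x)⁻¹ (α_s (b))` and `α_x⁻¹ (b)` are the same vector. -/
theorem form_single_action (f : G × S →₀ A) (g : G) (s x : S) (b : A) :
    form α N ρ τ f (Finsupp.single (g, s * x) (α s b)) =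
      form α N ρ τ f (Finsupp.single (g, x) b) := by
  refine form_single_right_congr (p := (g, s * x)) (q := (g, x)) rfl (fun z a => ?_) f
  rw [kernel_common hs g (X := z * (s * x)) (c := s * x) (d := z) (mul_comm _ _) rfl,
    kernel_same, hs s (star (α x a) * α (z * x) 1 * α z b)]
  simp only [map_mul (α _), map_star, ← action_mul]
  have e1 : s * (z * x) = z * (s * x) := mul_left_comm _ _ _
  rw [e1, mul_comm z s, mul_left_comm z s x, map_mul N s, map_mul ρ, Positive.val_mul]
  push_cast
  ring

theorem form_leftMul (c : A) (f k : G × S →₀ A) :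
    form α N ρ τ (leftMul α c f) k = form α N ρ τ f (leftMul α (star c) k) := by
  refine form_adjoint_of_single (fun g x a g' z b => ?_) f k
  rw [leftMul_single, leftMul_single, form_single_single, form_single_single]
  by_cases h : g = g'
  · subst h
    rw [kernel_same, kernel_same]
    simp only [map_mul (α _), star_mul, ← action_mul, ← map_star]
    simp only [← mul_assoc]
    rw [mul_assoc _ _ (α (x * z) 1), mul_assoc _ (α (x * z) 1) (α (x * z) _), mul_comm z x,
      ← map_mul, ← map_mul, mul_one, one_mul]
  · rw [kernel_of_ne _ _ _ _ h, kernel_of_ne _ _ _ _ h]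

theorem form_shift (s : S) (f k : G × S →₀ A) :
    form α N ρ τ (shift α N s f) k = form α N ρ τ f (backShift N s k) := by
  refine form_adjoint_of_single (fun g x a g' z b => ?_) f k
  rw [shift_single, backShift_single, form_single_single, form_single_single]
  by_cases h : N s * g = g'
  · subst h
    rw [inv_mul_cancel_left, kernel_same, kernel_same]
    simp only [map_mul (α _), star_mul, ← action_mul, star_action_unit]
    have e1 : z * (s * x) = x * z * s := by rw [mul_left_comm, mul_comm s, mul_comm z]
    have e2 : x * (s * z) = x * z * s := by rw [mul_left_comm, mul_comm s]
    rw [e1, e2, mul_assoc (star _), action_mul_unit, mul_comm z s, map_mul N (x * z), map_mul ρ,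
      map_mul ρ, Positive.val_mul, Positive.val_mul]
    push_cast
    ring
  · have h' : g ≠ (N s)⁻¹ * g' := fun e => h (by rw [e, mul_inv_cancel_left])
    rw [kernel_of_ne _ _ _ _ h, kernel_of_ne _ _ _ _ h']

/-- The vector state `b ↦ ⟪ξ, b ξ⟫` of a covariant representation. -/
theorem exists_vectorState {H : Type w} [NormedAddCommGroup H] [InnerProductSpace ℂ H]
    [CompleteSpace H] (p : CovariantPair α (H →L[ℂ] H)) (ξ : H) (hξ : inner ℂ ξ ξ = (1 : ℂ)) :
    ∃ φ : CrossedProduct α →L[ℂ] ℂ, IsState φ ∧ ∀ x a y,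
      φ (monomial α x a y) = inner ℂ (p.v x ξ) (p.ι a (p.v y ξ)) := by
  let L : CrossedProduct α →L[ℂ] (H →L[ℂ] H) :=
    (lift α p : CrossedProduct α →ₗ[ℂ] (H →L[ℂ] H)).mkContinuous 1 fun b => by
      rw [one_mul]; exact NonUnitalStarAlgHom.norm_apply_le (lift α p) b
  have hL : ∀ b, L b = lift α p b := fun _ => rfl
  refine ⟨(innerSL ℂ ξ).comp ((ContinuousLinearMap.apply ℂ H ξ).comp L), ⟨fun b => ?_, ?_⟩,
    fun x a y => ?_⟩
  · change 0 ≤ inner ℂ ξ (L (star b * b) ξ)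
    rw [hL, map_mul, map_star, mul_apply_eq_comp, ContinuousLinearMap.star_eq_adjoint,
      ContinuousLinearMap.adjoint_inner_right, inner_self_eq_norm_sq_to_K]
    exact pow_nonneg (RCLike.ofReal_nonneg.mpr (norm_nonneg _)) 2
  · change inner ℂ ξ (L 1 ξ) = (1 : ℂ)
    rw [hL, map_one]
    exact hξ
  · change inner ℂ ξ (L (monomial α x a y) ξ) = _
    rw [hL, monomial, map_mul, map_mul, map_star, lift_V, lift_V, lift_ι, mul_apply_eq_comp,
      mul_apply_eq_comp, ContinuousLinearMap.star_eq_adjoint,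
      ContinuousLinearMap.adjoint_inner_right]

open Classical in
include hs in
/-- The vector state at `1 ⊗ δ_1`. -/
theorem exists_state_of_scaling (hN : Function.Injective N) (hτ : IsTracialState τ) :
    ∃ φ : CrossedProduct α →L[ℂ] ℂ, IsState φ ∧ ∀ x y a,
      φ (monomial α x a y) =
        if x = y then ((ρ (N x) : ℝ) : ℂ) * τ (a * α x 1) else 0 := by
  obtain ⟨H, _, _, _, j, p, hin, hι, hv⟩ := exists_covariantPair_of_form α (formCore hτ hs)
    (leftMul α) (shift α N) (backShift N)
    form_leftMul
    (fun a b => form_congr_of_single (T' := leftMul α a ∘ₗ leftMul α b) fun g x c f => by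
      simp only [LinearMap.comp_apply, leftMul_single, map_mul, mul_assoc])
    (form_congr_of_single (T' := LinearMap.id) fun g x c f => by
      rw [leftMul_single, form_single_unit_mul]; rfl)
    form_shift
    (fun s => form_congr_of_single (T := backShift N s ∘ₗ shift α N s) (T' := LinearMap.id)
      fun g x c f => by
        rw [LinearMap.comp_apply, shift_single, backShift_single, inv_mul_cancel_left,
          form_single_unit_mul, form_single_action hs]; rfl)
    (fun s t => form_congr_of_single (T' := shift α N s ∘ₗ shift α N t) fun g x c f => by
      have e : s * t * x = s * x * t := mul_right_comm _ _ _
      rw [LinearMap.comp_apply, shift_single, shift_single, shift_single, map_mul (α s),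
        ← action_mul, ← action_mul, ← mul_assoc (α (s * x) 1), ← mul_assoc s t, e,
        action_unit_mul, map_mul N, mul_assoc])
    (form_congr_of_single (T' := LinearMap.id) fun g x c f => by
      rw [shift_single, map_one N, one_mul, one_mul, action_one, form_single_unit_mul]; rfl)
    (fun s a => form_congr_of_single
      (T := shift α N s ∘ₗ leftMul α a ∘ₗ backShift N s) fun g x c f => by
        have e : α (s * (s * x)) 1 * α s (α (s * x) a * c) = α s (α (s * x) a * c) := by
          rw [map_mul (α s), ← action_mul, ← mul_assoc, ← map_mul, one_mul]
        rw [LinearMap.comp_apply, LinearMap.comp_apply, backShift_single, leftMul_single,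
          shift_single, leftMul_single, mul_inv_cancel_left, e, form_single_action hs, ← action_mul,
          mul_comm x s])
  obtain ⟨φ, hφ, h⟩ := exists_vectorState p (j (Finsupp.single (1, 1) 1)) (by
    rw [hin]
    change form α N ρ τ _ _ = 1
    rw [form_single_single, kernel_same]
    simp [hτ.1.2])
  refine ⟨φ, hφ, fun x y a => ?_⟩
  rw [h, hv, hv, hι, hin]
  change form α N ρ τ _ _ = _
  rw [shift_single, shift_single, leftMul_single, form_single_single, mul_one, mul_one]
  split_ifs with hxy
  · subst hxy
    have e : α x (1 : A) * α x 1 = α x 1 := by rw [← map_mul, one_mul]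
    rw [kernel_same]
    simp only [mul_one, action_one, map_one N, map_one ρ, e, star_action_unit]
    rw [hτ.2, mul_assoc, e, Positive.val_one, mul_one]
  · exact kernel_of_ne _ _ _ _ (fun e => hxy (hN (by simpa using e))) _ _

end

/-! ### The correspondence -/

section

/-- The homomorphism `r ↦ r ^ β` of the positive reals. -/
noncomputable def rpowHom (β : ℝ) : {r : ℝ // 0 < r} →* {r : ℝ // 0 < r} where
  toFun r := ⟨(r : ℝ) ^ β, Real.rpow_pos_of_pos r.2 β⟩
  map_one' := Subtype.ext (Real.one_rpow β)
  map_mul' r s := Subtype.ext (Real.mul_rpow r.2.le s.2.le)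

variable {A : Type u} [CStarAlgebra A] {S : Type v} [CancelCommMonoid S]
  {α : S →* (A →⋆ₙₐ[ℂ] A)} {N : S →* {r : ℝ // 0 < r}} {β : ℝ}

theorem exists_traceFormula (hN : Function.Injective N) {τ : A →L[ℂ] ℂ}
    (hτ : τ ∈ ScalingTraces α N β) :
    ∃ φ : CrossedProduct α →L[ℂ] ℂ, IsState φ ∧ TraceFormula α N β τ φ :=
  exists_state_of_scaling (ρ := rpowHom β) (ScalingTraces.eq_rpow_mul hτ) hN hτ.1

theorem TraceFormula.restrict_eq {τ : A →L[ℂ] ℂ} {φ : CrossedProduct α →L[ℂ] ℂ}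
    (h : TraceFormula α N β τ φ) : restrict α φ = τ := by
  ext a
  rw [restrict_apply, ← monomial_one_one, h, if_pos rfl, map_one N, action_one, mul_one,
    Positive.val_one, Real.one_rpow, Complex.ofReal_one, one_mul]

theorem TraceFormula.unique {τ : A →L[ℂ] ℂ} {φ ψ : CrossedProduct α →L[ℂ] ℂ}
    (hφ : TraceFormula α N β τ φ) (hψ : TraceFormula α N β τ ψ) : φ = ψ :=
  functional_ext α fun x y a => by rw [hφ, hψ]

/-- Restriction of KMS states to the coefficient algebra, as a bijection onto scaling traces. -/
noncomputable def kmsEquiv (hN : Function.Injective N) :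
    KMSStates α N β ≃ ScalingTraces α N β where
  toFun φ := ⟨restrict α φ, IsKMSState.restrict_mem φ.2⟩
  invFun τ := ⟨(exists_traceFormula hN τ.2).choose,
    (exists_traceFormula hN τ.2).choose_spec.2.isKMSState τ.2
      (exists_traceFormula hN τ.2).choose_spec.1⟩
  left_inv φ := Subtype.ext (TraceFormula.unique
    (exists_traceFormula hN (IsKMSState.restrict_mem φ.2)).choose_spec.2
    (IsKMSState.traceFormula hN φ.2))
  right_inv τ := Subtype.ext (exists_traceFormula hN τ.2).choose_spec.2.restrict_eq

theorem kmsEquiv_symm_traceFormula (hN : Function.Injective N) (τ : ScalingTraces α N β) :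
    TraceFormula α N β τ ((kmsEquiv hN).symm τ : KMSStates α N β) :=
  (exists_traceFormula hN τ.2).choose_spec.2

end

end SemigroupCrossedProduct

open Classical SemigroupCrossedProduct in
theorem theorem4p1 {A : Type u} [CStarAlgebra A] {S : Type v} [CancelCommMonoid S]
    (α : S →* (A →⋆ₙₐ[ℂ] A)) (N : S →* {r : ℝ // 0 < r}) (hN : Function.Injective N) (β : ℝ) :
    ∃ e : KMSStates α N β ≃ ScalingTraces α N β,
      ∀ (τ : ScalingTraces α N β) (φ : CrossedProduct α →L[ℂ] ℂ), IsState φ →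
        (φ = e.symm τ ↔
          ∀ (x y : S) (a : A), φ (star (V α x) * ι α a * V α y) =
            if x = y then (((N x : ℝ) ^ β : ℝ) : ℂ) * (τ : A →L[ℂ] ℂ) (a * α x 1) else 0) := by
  refine ⟨kmsEquiv hN, fun τ φ _ => ⟨?_, fun h => ?_⟩⟩
  · rintro rfl
    exact kmsEquiv_symm_traceFormula hN τ
  · exact TraceFormula.unique h (kmsEquiv_symm_traceFormula hN τ)
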